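/- For a real number $\delta$ let $\mathbb H_\delta=\{s\in\mathbb C:\operatorname{Re}s>\delta\}$. For a positive semi-definite kernel $\kappa:X\times X\to\mathbb C$ let $\mathscr H_\kappa$ denote the reproducing kernel Hilbert space of functions on $X$ with kernel $\kappa$, and say that a function $\varphi:X\to\mathbb C$ is a multiplier of $\mathscr H_\kappa$ of norm at most $1$ if $f\mapsto\varphi f$ is a bounded operator on $\mathscr H_\kappa$ of operator norm at most $1$. The kernel $\kappa$ has the $n$-point scalar Pick property if, for all distinct points $\lambda_1,\dots,\lambda_n\in X$ and all $w_1,\dots,w_n$ in the open unit disc such that the matrix $[(1-w_j\overline{w_k})\kappa(\lambda_j,\lambda_k)]_{j,k=1}^n$ is positive semi-definite, there is a multiplier $\varphi$ of $\mathscr H_\kappa$ of norm at most $1$ with $\varphi(\lambda_j)=w_j$ for $j=1,\dots,n$. Let $\varkappa(s,u)=\zeta(s+\overline u)$, $s,u\in\mathbb H_{1/2}$, be the Szegö–Dirichlet kernel of $\mathbb H_{1/2}$, where $\zeta$ is the Riemann zeta function, and let $\varkappa^m$ be its $m$-fold pointwise product, which is a positive semi-definite kernel. **Theorem.** For every positive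 integer $m$, the kernel $\varkappa^m$ does not have the $2$-point scalar Pick property. More precisely, $\frac13<\sqrt{1-\frac{\zeta(3)^2}{\zeta(2)\zeta(4)}}$, and for $\lambda_1=1$, $\lambda_2=2$, $w_1=0$ and every $w_2\in\mathbb C$ with $$\frac13<|w_2|<\sqrt{1-\frac{\zeta(3)^2}{\zeta(2)\zeta(4)}}$$ the matrix $[(1-w_j\overline{w_k})\,\zeta(\lambda_j+\overline{\lambda_k})^m]_{j,k=1}^2$ is positive semi-definite, the matrix $\Big[\frac{1-w_j\overline{w_k}}{\lambda_j+\overline{\lambda_k}}\Big]_{j,k=1}^2$ is not positive semi-definite, and there is no multiplier $\varphi$ of $\mathscr H_{\varkappa^m}$ of norm at most $1$ with $\varphi(1)=0$ and $\varphi(2)=w_2$. -/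

import Mathlib

open scoped ComplexOrder ComplexConjugate

noncomputable section

/-- A scalar kernel `κ`, regarded as a kernel with values in the bounded operators on `ℂ`:
`κ s u` acts by multiplication. Mathlib's construction of the reproducing kernel Hilbert space
takes its kernel in this form. -/
def operatorKernel {X : Type*} (κ : X → X → ℂ) : Matrix X X (ℂ →L[ℂ] ℂ) :=
  Matrix.of fun s u => κ s u • ContinuousLinearMap.id ℂ ℂ

/-- `κ` is a positive semi-definite kernel: it is Hermitian and
`∑ i, ∑ j, conj (c i) * κ (x i) (x j) * c j ≥ 0` for all finite families of points and scalars. -/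
def IsPosSemidefKernel {X : Type*} (κ : X → X → ℂ) : Prop :=
  (Matrix.of κ).PosSemidef

theorem operatorKernel_posSemidef {X : Type*} {κ : X → X → ℂ}
    (hκ : IsPosSemidefKernel κ) : (operatorKernel κ).PosSemidef := by
  have hsymm : ∀ s u, conj (κ s u) = κ u s := fun s u => hκ.1.apply u s
  have hH : (operatorKernel κ).IsHermitian := by
    ext s u
    simp [operatorKernel, ← hsymm u s, ← ContinuousLinearMap.one_def]
  have key : ∀ v : X →₀ ℂ, 0 ≤ RCLike.re (v.sum fun x w => v.sum fun x' w' =>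
      inner ℂ (operatorKernel κ x' x w) w') := by
    intro v
    have h := (Complex.le_def.mp (hκ.2 v)).1
    have e : (v.sum fun x w => v.sum fun x' w' => inner ℂ (operatorKernel κ x' x w) w')
        = v.sum fun i xi => v.sum fun j xj => star xi * Matrix.of κ i j * xj := by
      refine Finsupp.sum_congr fun x _ => Finsupp.sum_congr fun x' _ => ?_
      simp [operatorKernel, hsymm]
      ring
    rw [e]
    exact h
  exact (RKHS.posSemidef_tfae.out 0 2).mpr (And.intro hH key)

instance operatorKernel_fact {X : Type*} {κ : X → X → ℂ} [hκ : Fact (IsPosSemidefKernel κ)] :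
    Fact (operatorKernel κ).PosSemidef :=
  ⟨operatorKernel_posSemidef hκ.out⟩

/-- The reproducing kernel Hilbert space `ℋ_κ` of a positive semi-definite kernel `κ`: the Hilbert
space of functions on `X` with reproducing kernel `κ`. -/
abbrev KernelSpace {X : Type*} (κ : X → X → ℂ) [Fact (IsPosSemidefKernel κ)] : Type _ :=
  RKHS.OfKernel (operatorKernel κ)

/-- `φ` is a multiplier of `ℋ_κ` of norm at most `1`: multiplication by `φ` is a bounded
operator on `ℋ_κ` whose operator norm is at most `1`. -/
def IsContractiveMultiplier {X : Type*} (κ : X → X → ℂ) [Fact (IsPosSemidefKernel κ)]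
    (φ : X → ℂ) : Prop :=
  ∃ M : KernelSpace κ →L[ℂ] KernelSpace κ,
    (∀ (f : KernelSpace κ) (s : X), (M f) s = φ s * f s) ∧ ‖M‖ ≤ 1

/-- The Pick matrix `[(1 - w_j conj(w_k)) κ(x_j, x_k)]`. -/
def pickMatrix {X : Type*} {n : ℕ} (κ : X → X → ℂ) (x : Fin n → X) (w : Fin n → ℂ) :
    Matrix (Fin n) (Fin n) ℂ :=
  Matrix.of fun j k => (1 - w j * conj (w k)) * κ (x j) (x k)

/-- The `n`-point scalar Pick property of `κ`: interpolation data with nodes that are distinct and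
targets in the open unit disc are interpolated by a multiplier of norm at most `1` as soon as
their Pick matrix is positive semi-definite. -/
def HasScalarPickProperty {X : Type*} (n : ℕ) (κ : X → X → ℂ) [Fact (IsPosSemidefKernel κ)] :
    Prop :=
  ∀ (x : Fin n → X) (w : Fin n → ℂ), Function.Injective x → (∀ j, ‖w j‖ < 1) →
    (pickMatrix κ x w).PosSemidef →
      ∃ φ : X → ℂ, IsContractiveMultiplier κ φ ∧ ∀ j, φ (x j) = w j

/-- The open right half-plane of the complex numbers with real part larger than `δ`. -/
abbrev RightHalfPlane (δ : ℝ) : Type := {s : ℂ // δ < s.re}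

/-- The Szegö–Dirichlet kernel `(s, u) ↦ ζ(s + conj u)` of the half-plane `Re > 1/2`. -/
def szegoDirichletKernel (s u : RightHalfPlane (1 / 2)) : ℂ :=
  riemannZeta (s + conj (u : ℂ))

/-- The kernel `(s, u) ↦ 1 / (s + conj u)` of the half-plane `Re > 0`, restricted to
`Re > 1/2`. -/
def halfPlaneKernel (s u : RightHalfPlane (1 / 2)) : ℂ :=
  1 / (s + conj (u : ℂ))

theorem szegoDirichletKernel_hasSum (s u : RightHalfPlane (1 / 2)) :
    HasSum (fun n : ℕ => ((n : ℂ) + 1) ^ (-(s : ℂ)) * conj (((n : ℂ) + 1) ^ (-(u : ℂ))))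
      (szegoDirichletKernel s u) := by
  have hs : 1 < ((s : ℂ) + conj (u : ℂ)).re := by
    have h1 := s.2
    have h2 := u.2
    simp only [Complex.add_re, Complex.conj_re]
    linarith
  have hsum : Summable fun n : ℕ => 1 / ((n : ℂ) + 1) ^ ((s : ℂ) + conj (u : ℂ)) := by
    simpa using (summable_nat_add_iff 1).mpr (Complex.summable_one_div_nat_cpow.mpr hs)
  have h := hsum.hasSum
  rw [← zeta_eq_tsum_one_div_nat_add_one_cpow hs] at h
  refine h.congr_fun fun n => ?_
  have hn : (n : ℂ) + 1 ≠ 0 := by exact_mod_cast n.succ_ne_zero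
  have harg : ((n : ℂ) + 1).arg ≠ Real.pi := by
    have h0 : ((n : ℂ) + 1).arg = 0 := by exact_mod_cast Complex.natCast_arg (n := n + 1)
    rw [h0]
    exact Real.pi_ne_zero.symm
  have hc : conj ((n : ℂ) + 1) = (n : ℂ) + 1 := by simp
  have h2 := Complex.cpow_conj ((n : ℂ) + 1) (-(u : ℂ)) harg
  rw [hc] at h2
  rw [← h2, ← Complex.cpow_add _ _ hn,
    one_div (((n : ℂ) + 1) ^ ((s : ℂ) + conj (u : ℂ))), ← Complex.cpow_neg]
  congr 1
  simp only [map_neg]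
  ring

theorem szegoDirichletKernel_pow_posSemidef (m : ℕ) :
    IsPosSemidefKernel (szegoDirichletKernel ^ m) := by
  induction m with
  | zero =>
    refine ⟨by ext; simp, fun x => ?_⟩
    have e : (x.sum fun i xi => x.sum fun j xj =>
        star xi * (Matrix.of (szegoDirichletKernel ^ 0)) i j * xj)
        = star (x.sum fun _ xi => xi) * (x.sum fun _ xi => xi) := by
      simp [Finsupp.sum, Finset.sum_mul_sum]
    rw [e]
    exact star_mul_self_nonneg _
  | succ m ih =>
    refine ⟨?_, fun x => ?_⟩
    · ext s u
      simp only [Matrix.conjTranspose_apply, Matrix.of_apply, pow_succ]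
      simp [szegoDirichletKernel, ← riemannZeta_conj, add_comm]
    · have hs : HasSum (fun n : ℕ => x.sum fun i xi => x.sum fun j xj =>
          star xi * (((n : ℂ) + 1) ^ (-(i : ℂ)) * conj (((n : ℂ) + 1) ^ (-(j : ℂ))) *
            (szegoDirichletKernel ^ m) i j) * xj)
          (x.sum fun i xi => x.sum fun j xj =>
            star xi * (Matrix.of (szegoDirichletKernel ^ (m + 1))) i j * xj) := by
        refine hasSum_sum fun i _ => hasSum_sum fun j _ => ?_
        have h := (((szegoDirichletKernel_hasSum i j).mul_right
          ((szegoDirichletKernel ^ m) i j)).mul_left (star (x i))).mul_right (x j)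
        simpa [pow_succ', mul_assoc] using h
      refine hs.nonneg fun n => ?_
      have h := ih.2 (Finsupp.onFinset x.support
        (fun i => conj (((n : ℂ) + 1) ^ (-(i : ℂ))) * x i) (by
          intro i hi; simp at hi ⊢; exact hi.2))
      rw [Finsupp.onFinset_sum _ (by simp)] at h
      convert h using 1
      refine Finset.sum_congr rfl fun i _ => ?_
      rw [Finsupp.onFinset_sum _ (by simp)]
      refine Finset.sum_congr rfl fun j _ => ?_
      simp only [Matrix.of_apply, star_mul', Complex.star_def, Complex.conj_conj]
      ring

instance szegoDirichletKernel_pow_fact (m : ℕ) : Fact (IsPosSemidefKernel (szegoDirichletKernel ^ m)) :=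
  ⟨szegoDirichletKernel_pow_posSemidef m⟩

/-- The two nodes `1` and `2` in the half-plane `Re > 1/2`. -/
def nodes : Fin 2 → RightHalfPlane (1 / 2) :=
  ![⟨1, by norm_num⟩, ⟨2, by norm_num⟩]

end

/-! A contractive multiplier of the space of `ζ(s + conj u) ^ m` behaves like a function on all of
`Re s > 0` bounded by `1`, and Schwarz's lemma there is stricter than the Pick condition of `ζ ^ m`.
Write `d_m` for the `m`-fold divisor function. In the orthonormal basis `√(d_m(n)) * n ^ (-s)`,
multiplication by `φ` becomes a contraction `B` of `ℓ²` (`exists_feature_operator`), and `φ` is a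
Dirichlet series on `Re s > 1/2`. Its truncation to the `N`-smooth numbers is, up to conjugation, an
eigenvalue of the adjoint of `B` for every `Re u > 0`, hence bounded by `1` there
(`norm_lseries_smoothPart_le_one`). Schwarz's lemma for the truncations and `N → ∞` give `‖φ 2‖ ≤ 1
/ 3` when `φ 1 = 0` (`norm_multiplier_two_le`). The Pick matrix, however, only requires `‖w₂‖ ^ 2 ≤
1 - (ζ(3)² / (ζ(2) ζ(4))) ^ m`, and `ζ(3)² / (ζ(2) ζ(4)) < 8 / 9` leaves room above `1 / 3`. -/

/-- A contractive multiplier of the kernel space of `κ` acts on every Hilbert space `E` carrying a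
feature map `v` of `κ`, by a contraction whose adjoint has the vectors `v s` as eigenvectors. -/
theorem IsContractiveMultiplier.exists_feature_operator {X E : Type*} {κ : X → X → ℂ}
    [Fact (IsPosSemidefKernel κ)] [NormedAddCommGroup E] [InnerProductSpace ℂ E] [CompleteSpace E]
    {φ : X → ℂ} (hφ : IsContractiveMultiplier κ φ) (v : X → E)
    (hv : ∀ s u, inner ℂ (v s) (v u) = κ s u) :
    ∃ B : E →L[ℂ] E, ‖B‖ ≤ 1 ∧ ∀ s x, inner ℂ (v s) (B x) = φ s * inner ℂ (v s) x := by
  obtain ⟨M, hM, hM1⟩ := hφ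
  let k : X → KernelSpace κ := fun x => RKHS.kerFun (KernelSpace κ) x 1
  have hk : ∀ s (f : KernelSpace κ), inner ℂ (k s) f = f s := fun s f => by
    simp [k]
  have hkk : ∀ s u, inner ℂ (k s) (k u) = κ s u := fun s u => by
    rw [hk, RKHS.kerFun_apply, RKHS.OfKernel.kernel_ofKernel]
    simp [operatorKernel]
  let e := Finsupp.linearCombination ℂ k
  let f := Finsupp.linearCombination ℂ v
  have hef : ∀ a b, inner ℂ (f a) (f b) = inner ℂ (e a) (e b) := fun a b => by
    simp only [e, f, Finsupp.linearCombination_apply, Finsupp.sum_inner, Finsupp.inner_sum,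
      inner_smul_left, inner_smul_right, hv, hkk]
  have hnorm : ∀ a, ‖f a‖ = ‖e a‖ := fun a => by
    rw [@norm_eq_sqrt_re_inner ℂ, hef, ← @norm_eq_sqrt_re_inner ℂ]
  have hdense : DenseRange e := by
    have h := RKHS.kerFun_dense (KernelSpace κ)
    rw [← Submodule.dense_iff_topologicalClosure_eq_top] at h
    refine h.mono ?_
    have hr : Set.range e = (LinearMap.range e : Set (KernelSpace κ)) := rfl
    rw [hr, SetLike.coe_subset_coe, Submodule.span_le]
    rintro _ ⟨x, z, rfl⟩
    exact ⟨Finsupp.single x z, by simp [e, k, ← map_smul]⟩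
  -- `J` is the isometry from the kernel space to `E` with `k s ↦ v s`. Conjugating `M` by it gives
  -- an operator that vanishes on the orthogonal complement of the `v s`.
  let J := f.extendOfNorm e
  have hJe : ∀ a, J (e a) = f a :=
    LinearMap.extendOfNorm_eq hdense ⟨1, fun a => by rw [one_mul, hnorm a]⟩
  have hJk : ∀ s, J (k s) = v s := fun s => by
    simpa [e, f] using hJe (Finsupp.single s 1)
  have hJ1 : ‖J‖ ≤ 1 := LinearMap.opNorm_extendOfNorm_le hdense zero_le_one
    fun a => by rw [one_mul, hnorm a]
  have hJ : ∀ s g, inner ℂ (v s) (J g) = g s := fun s g => by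
    rw [← hk, ← hJk]
    refine hdense.induction_on (p := fun g => inner ℂ (J (k s)) (J g) = inner ℂ (k s) g) g
      (isClosed_eq (by fun_prop) (by fun_prop)) fun a => ?_
    have := hef (Finsupp.single s 1) a
    rwa [← hJe, ← hJe, show e (Finsupp.single s 1) = k s by simp [e]] at this
  refine ⟨J ∘L M ∘L J.adjoint, ?_, fun s x => ?_⟩
  · have h := ContinuousLinearMap.opNorm_comp_le J (M ∘L J.adjoint)
    have h' := ContinuousLinearMap.opNorm_comp_le M J.adjoint
    have hA : ‖J.adjoint‖ ≤ 1 := by simpa using hJ1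
    refine h.trans (mul_le_one₀ hJ1 (norm_nonneg _) (h'.trans (mul_le_one₀ hM1 (norm_nonneg _) hA)))
  · rw [ContinuousLinearMap.comp_apply, hJ, ContinuousLinearMap.comp_apply, hM, ← hk,
      ContinuousLinearMap.adjoint_inner_right, hJk]

/-! ### Schwarz's lemma in the half-plane -/

/-- Schwarz's lemma in the right half-plane, at the points `1` and `2`. -/
theorem dist_two_one_le_of_norm_le_one {g : ℂ → ℂ} (hd : DifferentiableOn ℂ g {s | 0 < s.re})
    (hg : ∀ s : ℂ, 0 < s.re → ‖g s‖ ≤ 1) : ‖g 2 - g 1‖ ≤ (1 + ‖g 1‖) / 3 := by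
  -- The Cayley map from the disc to the half-plane, with `0 ↦ 1` and `1 / 3 ↦ 2`.
  let c : ℂ → ℂ := fun z => (1 + z) / (1 - z)
  have hne : ∀ z ∈ Metric.ball (0 : ℂ) 1, 1 - z ≠ 0 := fun z hz h => by
    rw [sub_eq_zero] at h
    simp [← h] at hz
  have hc : ∀ z ∈ Metric.ball (0 : ℂ) 1, 0 < (c z).re := fun z hz => by
    have h0 : 0 < Complex.normSq (1 - z) := Complex.normSq_pos.mpr (hne z hz)
    have h1 : Complex.normSq z < 1 := by
      rw [mem_ball_zero_iff] at hz
      rw [Complex.normSq_eq_norm_sq]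
      nlinarith [norm_nonneg z]
    have h2 : (c z).re = (1 - Complex.normSq z) / Complex.normSq (1 - z) := by
      rw [Complex.div_re, ← add_div]
      congr 1
      simp [Complex.normSq_apply]
      ring
    rw [h2]
    exact div_pos (by linarith) h0
  have hcd : DifferentiableOn ℂ c (Metric.ball 0 1) :=
    DifferentiableOn.div (by fun_prop) (by fun_prop) hne
  -- The radius `1 + ‖g 1‖` is crude, but sharp in the limit case `g 1 = 0`.
  have h := Complex.dist_le_div_mul_dist_of_mapsTo_ball (f := g ∘ c) (R₂ := 1 + ‖g 1‖)
    (z := 1 / 3) (hd.comp hcd hc) (fun z hz => by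
      rw [mem_closedBall_iff_norm]
      refine (norm_sub_le _ _).trans (add_le_add (hg _ (hc z hz)) ?_)
      simp [c]) (by simp; norm_num)
  have h1 : c 0 = 1 := by simp [c]
  have h2 : c (1 / 3) = 2 := by simp only [c]; norm_num
  simp only [Function.comp_apply, h1, h2, dist_eq_norm] at h
  norm_num at h
  linarith

/-! ### Smooth numbers and Dirichlet series -/

/-- The set of `N`-smooth numbers contains a given number as soon as `N` is large. -/
theorem Nat.eventually_mem_smoothNumbers {n : ℕ} (hn : n ≠ 0) :
    ∀ᶠ N in Filter.atTop, n ∈ Nat.smoothNumbers N := by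
  filter_upwards [Filter.eventually_gt_atTop n] with N hN
  exact Nat.mem_smoothNumbers_of_lt (Nat.pos_of_ne_zero hn) hN

theorem Nat.mul_mem_smoothNumbers_iff {N a b : ℕ} :
    a * b ∈ Nat.smoothNumbers N ↔ a ∈ Nat.smoothNumbers N ∧ b ∈ Nat.smoothNumbers N :=
  ⟨fun h => ⟨Nat.mem_smoothNumbers_of_dvd h (dvd_mul_right a b),
    Nat.mem_smoothNumbers_of_dvd h (dvd_mul_left b a)⟩, fun h => Nat.mul_mem_smoothNumbers h.1 h.2⟩

theorem LSeries.term_mul_apply (c x : ℕ → ℂ) (s : ℂ) (n : ℕ) :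
    LSeries.term (fun n => c n * x n) s n = LSeries.term c s n * x n := by
  rcases eq_or_ne n 0 with rfl | hn
  · simp
  · simp [LSeries.term_of_ne_zero hn, div_mul_eq_mul_div]

/-- The coefficients of the Dirichlet series obtained from `∑ b n * n ^ (-s)` by multiplication
with `c l * l ^ (-s)`. -/
theorem LSeriesHasSum.dilate {b : ℕ → ℂ} {s a : ℂ} (h : LSeriesHasSum b s a) (c : ℕ → ℂ) (l : ℕ) :
    LSeriesHasSum (fun n => if l ∣ n then c l * b (n / l) else 0) s (LSeries.term c s l * a) := by
  rcases eq_or_ne l 0 with rfl | hl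
  · rw [LSeries.term_zero, zero_mul]
    refine hasSum_zero.congr_fun fun n => ?_
    rcases eq_or_ne n 0 with rfl | hn
    · simp
    · simp [hn]
  · refine ((mul_right_injective₀ hl).hasSum_iff fun n hn => ?_).mp
      ((HasSum.mul_left (LSeries.term c s l) h).congr_fun fun n => ?_)
    · rcases eq_or_ne n 0 with rfl | hn0
      · simp
      · have : ¬ l ∣ n := fun ⟨k, hk⟩ => hn ⟨k, hk.symm⟩
        simp [LSeries.term_of_ne_zero hn0, this]
    · rcases eq_or_ne n 0 with rfl | hn
      · simp
      · simp only [Function.comp_apply, LSeries.term_of_ne_zero hn, LSeries.term_of_ne_zero hl,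
          LSeries.term_of_ne_zero (mul_ne_zero hl hn), dvd_mul_right, if_true,
          Nat.mul_div_cancel_left _ (Nat.pos_of_ne_zero hl)]
        rw [Nat.cast_mul, Complex.natCast_mul_natCast_cpow, div_mul_div_comm]

/-! ### Multiplication operators on `ℓ²` and their smooth truncations -/

section smooth

variable {c : ℕ → ℂ} {φ : ℂ → ℂ} {B : lp (fun _ : ℕ => ℂ) 2 →L[ℂ] lp (fun _ : ℕ => ℂ) 2}

/-- The restriction of a sequence to the `N`-smooth numbers. -/
noncomputable def smoothPart (N : ℕ) (c : ℕ → ℂ) : ℕ → ℂ := (Nat.smoothNumbers N).indicator c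

theorem smoothPart_mul (N : ℕ) (c x : ℕ → ℂ) :
    smoothPart N (fun n => c n * x n) = fun n => smoothPart N c n * x n := by
  ext n
  by_cases h : n ∈ Nat.smoothNumbers N <;> simp [smoothPart, h]

theorem memℓp_two_conj {f : ℕ → ℂ} (h : Memℓp f 2) : Memℓp (fun n => conj (f n)) 2 := by
  rw [memℓp_gen_iff (by norm_num)] at h ⊢
  simpa using h

/-- The inner product is conjugate-linear in its first argument, so the conjugated vector is the one
that represents evaluation at `s`. -/
theorem lseriesHasSum_mul_of_memℓp {s : ℂ} (h : Memℓp (LSeries.term c s) 2)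
    (x : lp (fun _ : ℕ => ℂ) 2) :
    LSeriesHasSum (fun n => c n * x n) s
      (inner ℂ (⟨_, memℓp_two_conj h⟩ : lp (fun _ : ℕ => ℂ) 2) x) := by
  refine (lp.hasSum_inner (𝕜 := ℂ) (⟨_, memℓp_two_conj h⟩ : lp (fun _ : ℕ => ℂ) 2) x).congr_fun
    fun n => ?_
  simp [LSeries.term_mul_apply, mul_comm]

/-- The hypotheses say that `B` is the operator of multiplication by `φ` in the orthonormal basis
`c n * n ^ (-s)`. Its matrix entries are then determined by those in the first column. -/
theorem multiplication_matrix_entry (hc1 : c 1 = 1)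
    (hc : ∀ s : ℂ, 1 / 2 < s.re → Memℓp (LSeries.term c s) 2)
    (hB : ∀ s : ℂ, 1 / 2 < s.re → ∀ x,
      LSeries (fun n => c n * B x n) s = φ s * LSeries (fun n => c n * x n) s)
    (l : ℕ) {n : ℕ} (hn : n ≠ 0) :
    c n * B (lp.single 2 l 1) n =
      if l ∣ n then c l * (c (n / l) * B (lp.single 2 1 1) (n / l)) else 0 := by
  have hsum : ∀ x : lp (fun _ : ℕ => ℂ) 2, ∀ s : ℂ, 1 / 2 < s.re →
      LSeriesSummable (fun n => c n * x n) s :=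
    fun x s hs => (lseriesHasSum_mul_of_memℓp (hc s hs) x).LSeriesSummable
  have hsingle : ∀ l s, LSeries (fun n => c n * (lp.single 2 l 1 : lp (fun _ : ℕ => ℂ) 2) n) s
      = LSeries.term c s l := fun l s => by
    rw [LSeries, tsum_eq_single l]
    · rw [LSeries.term_mul_apply]; simp
    · intro k hk
      rw [LSeries.term_mul_apply]; simp [hk]
  -- As `c 1 = 1`, the first basis function is the constant `1`, so its image is `φ`. The image of
  -- the `l`-th is then `φ` times `c l * l ^ (-s)`, and uniqueness of Dirichlet coefficients
  -- finishes.
  have hdil : ∀ s : ℂ, 1 / 2 < s.re → LSeriesHasSum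
      (fun n => if l ∣ n then c l * (c (n / l) * B (lp.single 2 1 1) (n / l)) else 0) s
      (LSeries (fun n => c n * B (lp.single 2 l 1) n) s) := fun s hs => by
    have h := (hsum (B (lp.single 2 1 1)) s hs).LSeriesHasSum.dilate c l
    rwa [hB s hs, hsingle, LSeries.term_of_ne_zero one_ne_zero, hc1, Nat.cast_one,
      Complex.one_cpow, div_one, mul_one, mul_comm, ← hsingle l s, ← hB s hs] at h
  have h1 : (1 / 2 : ℝ) < (1 : ℂ).re := by norm_num
  refine LSeries.eq_of_LSeries_eventually_eq
    ((hsum _ 1 h1).abscissaOfAbsConv_le.trans_lt (EReal.coe_lt_top _))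
    ((hdil 1 h1).LSeriesSummable.abscissaOfAbsConv_le.trans_lt (EReal.coe_lt_top _)) ?_ hn
  filter_upwards [Filter.eventually_gt_atTop (1 / 2 : ℝ)] with x hx
  exact (hdil x (by simpa using hx)).LSeries_eq.symm

theorem lseriesHasSum_smoothPart_mul {N : ℕ} {u : ℂ}
    (hu : Memℓp (LSeries.term (smoothPart N c) u) 2) (x : lp (fun _ : ℕ => ℂ) 2) :
    LSeriesHasSum (smoothPart N fun n => c n * x n) u
      (inner ℂ (⟨_, memℓp_two_conj hu⟩ : lp (fun _ : ℕ => ℂ) 2) x) := by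
  rw [smoothPart_mul]
  exact lseriesHasSum_mul_of_memℓp hu x

/-- A product is smooth exactly when both factors are, so truncation respects multiplication. Hence
the truncated evaluation vector at `u` is an eigenvector of the adjoint of `B`, even where
evaluation on the whole space is unbounded. -/
theorem norm_lseries_smoothPart_le_one (hc1 : c 1 = 1)
    (hc : ∀ s : ℂ, 1 / 2 < s.re → Memℓp (LSeries.term c s) 2)
    (hB : ∀ s : ℂ, 1 / 2 < s.re → ∀ x,
      LSeries (fun n => c n * B x n) s = φ s * LSeries (fun n => c n * x n) s)
    (hB1 : ‖B‖ ≤ 1) {N : ℕ} {u : ℂ} (hu : Memℓp (LSeries.term (smoothPart N c) u) 2) :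
    ‖LSeries (smoothPart N fun n => c n * B (lp.single 2 1 1) n) u‖ ≤ 1 := by
  set b : ℕ → ℂ := smoothPart N fun n => c n * B (lp.single 2 1 1) n with hb
  let x : lp (fun _ : ℕ => ℂ) 2 := ⟨_, memℓp_two_conj hu⟩
  have hx1 : x 1 = 1 := by
    have h1 : 1 ∈ Nat.smoothNumbers N := by simp [Nat.mem_smoothNumbers]
    simp [x, LSeries.term_of_ne_zero, smoothPart, hc1, h1]
  have hx0 : 0 < ‖x‖ := norm_pos_iff.mpr fun h => by simp [h] at hx1
  have key : B.adjoint x = conj (LSeries b u) • x := by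
    ext l
    have h1 : B.adjoint x l = inner ℂ (lp.single 2 l 1 : lp (fun _ : ℕ => ℂ) 2) (B.adjoint x) := by
      rw [lp.inner_single_left]; simp
    have h2 : LSeriesHasSum (smoothPart N fun n => c n * B (lp.single 2 l 1) n) u
        (LSeries.term (smoothPart N c) u l * LSeries b u) := by
      refine (LSeriesHasSum_congr u _ fun {n} hn => ?_).mpr
        ((lseriesHasSum_smoothPart_mul hu
          (B (lp.single 2 1 1))).LSeriesSummable.LSeriesHasSum.dilate (smoothPart N c) l)
      by_cases hl : l ∣ n
      · obtain ⟨k, rfl⟩ := hl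
        have hl0 : 0 < l := Nat.pos_of_ne_zero (left_ne_zero_of_mul hn)
        have := multiplication_matrix_entry hc1 hc hB l hn
        simp only [dvd_mul_right, if_true, Nat.mul_div_cancel_left _ hl0] at this ⊢
        by_cases h1 : l ∈ Nat.smoothNumbers N <;> by_cases h2 : k ∈ Nat.smoothNumbers N <;>
          simp [smoothPart, Set.indicator, Nat.mul_mem_smoothNumbers_iff, h1, h2, this]
      · have := multiplication_matrix_entry hc1 hc hB l hn
        simp only [hl, if_false] at this ⊢
        simp [smoothPart, Set.indicator, this]
    rw [h1, ContinuousLinearMap.adjoint_inner_right, ← inner_conj_symm,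
      HasSum.unique (lseriesHasSum_smoothPart_mul hu _) h2]
    simp [x, mul_comm]
  have h := B.adjoint.le_of_opNorm_le (c := 1) (by simpa using hB1) x
  rw [key, norm_smul, one_mul, RCLike.norm_conj] at h
  exact (mul_le_iff_le_one_left hx0).mp h

/-- The limit `N → ∞` is needed only at `1` and `2`, where the full series converges absolutely; `φ`
itself is never continued to `Re s > 0`. -/
theorem multiplier_norm_two_le (hc1 : c 1 = 1)
    (hc : ∀ s : ℂ, 1 / 2 < s.re → Memℓp (LSeries.term c s) 2)
    (hcN : ∀ (N : ℕ) (u : ℂ), 0 < u.re → Memℓp (LSeries.term (smoothPart N c) u) 2)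
    (hB : ∀ s : ℂ, 1 / 2 < s.re → ∀ x,
      LSeries (fun n => c n * B x n) s = φ s * LSeries (fun n => c n * x n) s)
    (hB1 : ‖B‖ ≤ 1) (hφ : φ 1 = 0) : ‖φ 2‖ ≤ 1 / 3 := by
  set b : ℕ → ℂ := fun n => c n * B (lp.single 2 1 1) n with hb
  have hbφ : ∀ s : ℂ, 1 / 2 < s.re → LSeriesHasSum b s (φ s) := fun s hs => by
    have h := (lseriesHasSum_mul_of_memℓp (hc s hs) (B (lp.single 2 1 1))).LSeriesSummable
    have h1 : LSeries b s = φ s := by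
      rw [hb, hB s hs, LSeries, tsum_eq_single 1]
      · rw [LSeries.term_mul_apply]; simp [LSeries.term_of_ne_zero, hc1]
      · intro k hk
        rw [LSeries.term_mul_apply]; simp [hk]
    exact h1 ▸ h.LSeriesHasSum
  have hlim : ∀ s : ℂ, 1 / 2 < s.re →
      Filter.Tendsto (fun N => LSeries (smoothPart N b) s) Filter.atTop (nhds (φ s)) := by
    intro s hs
    rw [← (hbφ s hs).LSeries_eq]
    refine tendsto_tsum_of_dominated_convergence (hbφ s hs).LSeriesSummable.norm
      (fun n => ?_) (Filter.Eventually.of_forall fun N n => ?_)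
    · rcases eq_or_ne n 0 with rfl | hn
      · simp
      · refine tendsto_const_nhds.congr' ?_
        filter_upwards [Nat.eventually_mem_smoothNumbers hn] with N hN
        simp [LSeries.term_of_ne_zero hn, smoothPart, hN]
    · exact LSeries.norm_term_le s (by
        by_cases h : n ∈ Nat.smoothNumbers N <;> simp [smoothPart, h])
  have hN : ∀ N, ‖LSeries (smoothPart N b) 2 - LSeries (smoothPart N b) 1‖
      ≤ (1 + ‖LSeries (smoothPart N b) 1‖) / 3 := fun N => by
    refine dist_two_one_le_of_norm_le_one ((LSeries_differentiableOn _).mono fun s hs => ?_)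
      fun s hs => norm_lseries_smoothPart_le_one hc1 hc hB hB1 (hcN N s hs)
    refine (LSeries.abscissaOfAbsConv_le_of_forall_lt_LSeriesSummable (x := 0)
      fun y hy => ?_).trans_lt (EReal.coe_lt_coe_iff.mpr hs)
    exact (lseriesHasSum_smoothPart_mul (hcN N y (by simpa using hy)) _).LSeriesSummable
  have h1 := hlim 1 (by norm_num)
  have h2 := hlim 2 (by norm_num)
  have h := le_of_tendsto_of_tendsto' (h2.sub h1).norm ((h1.norm.const_add 1).div_const 3) hN
  simpa [hφ] using h

end smooth

/-! ### Divisor functions and the space of `ζ ^ m` -/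

theorem ArithmeticFunction.LSeriesHasSum_pow {f : ArithmeticFunction ℕ} {s a : ℂ}
    (hf : LSeriesHasSum (fun n => (f n : ℂ)) s a) (m : ℕ) :
    LSeriesHasSum (fun n => ((f ^ m) n : ℂ)) s (a ^ m) := by
  induction m with
  | zero =>
    rw [pow_zero, pow_zero, LSeriesHasSum]
    convert hasSum_single (f := LSeries.term (fun n => ((1 : ArithmeticFunction ℕ) n : ℂ)) s) 1
      fun n hn => ?_ using 1
    · simp [LSeries.term_of_ne_zero]
    · rcases eq_or_ne n 0 with rfl | hn0
      · simp
      · simp [LSeries.term_of_ne_zero hn0, ArithmeticFunction.one_apply_ne hn]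
  | succ m ih =>
    have h := ArithmeticFunction.LSeriesHasSum_mul
      (f := ((f ^ m : ArithmeticFunction ℕ) : ArithmeticFunction ℂ))
      (g := (f : ArithmeticFunction ℂ)) (by simpa using ih) (by simpa using hf)
    rw [pow_succ, pow_succ]
    simpa [← ArithmeticFunction.natCoe_mul] using h

/-- The indicator function of the `N`-smooth numbers. -/
noncomputable def smoothIndicator (N : ℕ) : ArithmeticFunction ℕ :=
  ⟨(Nat.smoothNumbers N).indicator 1,
    Set.indicator_of_notMem (fun h => Nat.ne_zero_of_mem_smoothNumbers h rfl) _⟩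

theorem zeta_pow_le_smoothIndicator_pow {N n : ℕ} (m : ℕ) (hn : n ∈ Nat.smoothNumbers N) :
    (ArithmeticFunction.zeta ^ m) n ≤ (smoothIndicator N ^ m) n := by
  induction m generalizing n with
  | zero => simp
  | succ m ih =>
    rw [pow_succ, pow_succ, ArithmeticFunction.mul_apply, ArithmeticFunction.mul_apply]
    refine Finset.sum_le_sum fun x hx => ?_
    have hx' := (Nat.mem_divisorsAntidiagonal.mp hx).1
    rw [← hx', Nat.mul_mem_smoothNumbers_iff] at hn
    refine Nat.mul_le_mul (ih hn.1) ?_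
    rw [ArithmeticFunction.zeta_apply]
    have : smoothIndicator N x.2 = 1 := by
      simp [smoothIndicator, hn.2]
    rw [this]
    split_ifs <;> simp

/-- The Euler product has finitely many factors, each a geometric series convergent for `Re s > 0`.
-/
theorem lseriesSummable_smoothIndicator (N : ℕ) {s : ℂ} (hs : 0 < s.re) :
    LSeriesSummable (fun n => (smoothIndicator N n : ℂ)) s := by
  have hs0 : s ≠ 0 := fun h => by simp [h] at hs
  have h := (EulerProduct.summable_and_hasSum_smoothNumbers_prod_primesBelow_geometric
    (f := (riemannZetaSummandHom hs0 : ℕ →* ℂ)) (fun {p} hp => by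
      have : (1 : ℝ) < p := by exact_mod_cast hp.one_lt
      simpa [riemannZetaSummandHom, Complex.norm_natCast_cpow_of_pos hp.pos] using
        Real.rpow_lt_one_of_one_lt_of_neg this (by simpa using hs)) N).2.summable
  refine ((summable_subtype_iff_indicator (s := (Nat.smoothNumbers N : Set ℕ))
    (f := (riemannZetaSummandHom hs0 : ℕ → ℂ))).mp h).congr fun n => ?_
  rcases eq_or_ne n 0 with rfl | hn
  · simp [Set.indicator]
  · by_cases h : n ∈ Nat.smoothNumbers N <;>
      simp [h, LSeries.term_of_ne_zero hn, smoothIndicator, riemannZetaSummandHom, Complex.cpow_neg]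

/-- The norms `√(d_m(n))` of the functions `d_m(n) * n ^ (-s)` in the kernel space of `ζ ^ m`, where
`d_m` is the `m`-fold divisor function. -/
noncomputable def sqrtDivisor (m n : ℕ) : ℂ := (√((ArithmeticFunction.zeta ^ m) n : ℝ) : ℝ)

theorem norm_term_sqrtDivisor_sq (m : ℕ) (s : ℂ) (n : ℕ) :
    ‖LSeries.term (sqrtDivisor m) s n‖ ^ 2 =
      ‖LSeries.term (fun n => ((ArithmeticFunction.zeta ^ m) n : ℂ)) ((2 * s.re : ℝ) : ℂ) n‖ := by
  rcases eq_or_ne n 0 with rfl | hn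
  · simp
  · have hn' : (0 : ℝ) ≤ n := n.cast_nonneg
    simp only [LSeries.norm_term_eq, hn, if_false, sqrtDivisor, Complex.norm_real, div_pow,
      Real.norm_eq_abs, sq_abs, Complex.ofReal_re]
    rw [Real.sq_sqrt (by positivity), mul_comm 2 s.re, Real.rpow_mul hn']
    simp

theorem memℓp_two_of_norm_sq_le {f g : ℕ → ℂ} (hg : Summable g) (h : ∀ n, ‖f n‖ ^ 2 ≤ ‖g n‖) :
    Memℓp f 2 := by
  rw [memℓp_gen_iff (by norm_num)]
  refine Summable.of_nonneg_of_le (fun n => by positivity) (fun n => ?_) hg.norm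
  simpa using h n

theorem memℓp_term_sqrtDivisor (m : ℕ) {s : ℂ} (hs : 1 / 2 < s.re) :
    Memℓp (LSeries.term (sqrtDivisor m) s) 2 := by
  refine memℓp_two_of_norm_sq_le (ArithmeticFunction.LSeriesHasSum_pow
    (ArithmeticFunction.LSeriesSummable_zeta_iff (s := ((2 * s.re : ℝ) : ℂ)).mpr
      (by simp; linarith)).LSeriesHasSum m).LSeriesSummable
    fun n => (norm_term_sqrtDivisor_sq m s n).le

theorem memℓp_term_smoothPart_sqrtDivisor (m N : ℕ) {s : ℂ} (hs : 0 < s.re) :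
    Memℓp (LSeries.term (smoothPart N (sqrtDivisor m)) s) 2 := by
  refine memℓp_two_of_norm_sq_le (ArithmeticFunction.LSeriesHasSum_pow
    (lseriesSummable_smoothIndicator N (s := ((2 * s.re : ℝ) : ℂ))
      (by simpa using hs)).LSeriesHasSum m).LSeriesSummable fun n => ?_
  by_cases h : n ∈ Nat.smoothNumbers N
  · have hn := Nat.ne_zero_of_mem_smoothNumbers h
    have e : LSeries.term (smoothPart N (sqrtDivisor m)) s n = LSeries.term (sqrtDivisor m) s n := by
      simp [LSeries.term_of_ne_zero hn, smoothPart, h]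
    rw [e, norm_term_sqrtDivisor_sq]
    refine LSeries.norm_term_le _ ?_
    simpa using zeta_pow_le_smoothIndicator_pow m h
  · have e : LSeries.term (smoothPart N (sqrtDivisor m)) s n = 0 := by
      simp [LSeries.term_def, smoothPart, h]
    simp [e]

theorem inner_term_sqrtDivisor (m : ℕ) (s u : RightHalfPlane (1 / 2)) :
    inner ℂ (⟨_, memℓp_two_conj (memℓp_term_sqrtDivisor m s.2)⟩ : lp (fun _ : ℕ => ℂ) 2)
      (⟨_, memℓp_two_conj (memℓp_term_sqrtDivisor m u.2)⟩ : lp (fun _ : ℕ => ℂ) 2) =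
    (szegoDirichletKernel ^ m) s u := by
  have hs : 1 < ((s : ℂ) + conj (u : ℂ)).re := by
    have h1 := s.2
    have h2 := u.2
    simp only [Complex.add_re, Complex.conj_re]
    linarith
  refine (lp.hasSum_inner _ _).unique
    ((ArithmeticFunction.LSeriesHasSum_pow (ArithmeticFunction.LSeriesHasSum_zeta hs) m).congr_fun
      fun n => ?_)
  rcases eq_or_ne n 0 with rfl | hn
  · simp
  · have hc : conj ((n : ℂ) ^ (u : ℂ)) = (n : ℂ) ^ conj (u : ℂ) := by
      have := Complex.cpow_conj (n : ℂ) (u : ℂ)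
        (by rw [Complex.natCast_arg]; exact Real.pi_ne_zero.symm)
      rw [Complex.conj_natCast] at this
      rw [this]
    have hd : sqrtDivisor m n * sqrtDivisor m n = ((ArithmeticFunction.zeta ^ m) n : ℂ) := by
      rw [sqrtDivisor, ← Complex.ofReal_mul, Real.mul_self_sqrt (by positivity)]
      simp
    have hr : conj (sqrtDivisor m n) = sqrtDivisor m n := Complex.conj_ofReal _
    simp only [LSeries.term_of_ne_zero hn, RCLike.inner_apply, Complex.conj_conj, map_div₀, hc, hr]
    rw [Complex.cpow_add _ _ (by exact_mod_cast hn), ← hd]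
    field_simp

/-- A contractive multiplier of the kernel space of `ζ(s + conj u) ^ m` that vanishes at `1` obeys
the same bound at `2` as a function on the half-plane `Re s > 0` that is bounded by one. -/
theorem norm_multiplier_two_le (m : ℕ) {φ : RightHalfPlane (1 / 2) → ℂ}
    (hφ : IsContractiveMultiplier (szegoDirichletKernel ^ m) φ) (h0 : φ (nodes 0) = 0) :
    ‖φ (nodes 1)‖ ≤ 1 / 3 := by
  obtain ⟨B, hB1, hB⟩ := hφ.exists_feature_operator _ (inner_term_sqrtDivisor m)
  -- The value `0` is immaterial: only points with `Re s > 1/2` are used.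
  let ψ : ℂ → ℂ := fun s => if h : 1 / 2 < s.re then φ ⟨s, h⟩ else 0
  have h1 : ψ 1 = φ (nodes 0) := by
    have : (1 / 2 : ℝ) < (1 : ℂ).re := by norm_num
    simp only [ψ, this, dif_pos]; rfl
  have h2 : ψ 2 = φ (nodes 1) := by
    have : (1 / 2 : ℝ) < (2 : ℂ).re := by norm_num
    simp only [ψ, this, dif_pos]; rfl
  rw [← h2]
  refine multiplier_norm_two_le (c := sqrtDivisor m) (φ := ψ) (B := B) ?_
    (fun s hs => memℓp_term_sqrtDivisor m hs)
    (fun N s hs => memℓp_term_smoothPart_sqrtDivisor m N hs)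
    (fun s hs x => ?_) hB1 (h1.trans h0)
  · have : (ArithmeticFunction.zeta ^ m) 1 = 1 := by
      clear hφ hB
      induction m with
      | zero => simp
      | succ m ih => simp [pow_succ, ArithmeticFunction.mul_apply, ih]
    simp [sqrtDivisor, this]
  · have := hB ⟨s, hs⟩ x
    rw [(lseriesHasSum_mul_of_memℓp (memℓp_term_sqrtDivisor m hs) (B x)).LSeries_eq,
      (lseriesHasSum_mul_of_memℓp (memℓp_term_sqrtDivisor m hs) x).LSeries_eq]
    simpa only [ψ, hs, dif_pos] using this

/-! ### Numerical bounds for zeta values -/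

theorem riemannZeta_three_eq_ofReal :
    ∃ z : ℝ, riemannZeta 3 = z ∧ 0 ≤ z ∧ z ≤ 29 / 24 := by
  have hsum : HasSum (fun n : ℕ => 1 / ((n : ℝ) + 1) ^ 3) (∑' n : ℕ, 1 / ((n : ℝ) + 1) ^ 3) :=
    Summable.hasSum (by
      simpa using (summable_nat_add_iff 1).mpr
        (Real.summable_one_div_nat_pow.mpr (by norm_num : 1 < 3)))
  refine ⟨∑' n : ℕ, 1 / ((n : ℝ) + 1) ^ 3, ?_, tsum_nonneg fun n => by positivity, ?_⟩
  · have h := zeta_eq_tsum_one_div_nat_add_one_cpow (s := 3) (by norm_num)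
    rw [h, Complex.ofReal_tsum]
    refine tsum_congr fun n => ?_
    push_cast
    congr 1
    exact_mod_cast Complex.cpow_natCast ((n : ℂ) + 1) 3
  · refine le_of_tendsto hsum.tendsto_sum_nat ?_
    filter_upwards [Filter.eventually_ge_atTop 2] with N hN
    -- `29 / 24 = 1 + 1 / 8 + 1 / 12`, where `1 / 12` bounds the tail by telescoping `1 / k ^ 3 ≤ 1
    -- / ((k - 1) k (k + 1))`.
    have : ∑ n ∈ Finset.range N, 1 / ((n : ℝ) + 1) ^ 3
        ≤ 29 / 24 - 1 / (2 * (N : ℝ) * (N + 1)) := by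
      induction N, hN using Nat.le_induction with
      | base => norm_num [Finset.sum_range_succ]
      | succ N hN ih =>
        rw [Finset.sum_range_succ]
        have hN' : (2 : ℝ) ≤ N := by exact_mod_cast hN
        have : 1 / ((N : ℝ) + 1) ^ 3 ≤ 1 / (2 * N * (N + 1)) - 1 / (2 * (N + 1) * (N + 1 + 1)) := by
          have e : 1 / (2 * (N : ℝ) * (N + 1)) - 1 / (2 * (N + 1) * (N + 1 + 1))
              = 1 / (N * (N + 1) * (N + 2)) := by
            field_simp
            ring
          rw [e]
          exact one_div_le_one_div_of_le (by positivity) (by nlinarith)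
        push_cast
        linarith
    have h0 : 0 ≤ 1 / (2 * (N : ℝ) * (N + 1)) := by positivity
    linarith

/-- The value `ζ(3)² / (ζ(2) ζ(4))` is a nonnegative real number below `8 / 9`. -/
theorem zeta_ratio_lt : ∃ a b d : ℝ, riemannZeta 2 = a ∧ riemannZeta 3 = b ∧ riemannZeta 4 = d ∧
    0 < a ∧ 0 ≤ b ∧ 0 < d ∧ b ^ 2 / (a * d) < 8 / 9 := by
  obtain ⟨b, hb, hb0, hb1⟩ := riemannZeta_three_eq_ofReal
  refine ⟨Real.pi ^ 2 / 6, b, Real.pi ^ 4 / 90, by simp [riemannZeta_two], hb,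
    by simp [riemannZeta_four], by positivity, hb0, by positivity, ?_⟩
  rw [div_lt_iff₀ (by positivity)]
  have h1 : (3.14 : ℝ) ^ 6 ≤ Real.pi ^ 6 := by
    gcongr
    exact Real.pi_gt_d2.le
  have h2 : b ^ 2 ≤ (29 / 24) ^ 2 := by gcongr
  have h3 : Real.pi ^ 2 / 6 * (Real.pi ^ 4 / 90) = Real.pi ^ 6 / 540 := by ring
  rw [h3]
  norm_num at h1 h2
  linarith

/-! ### Pick matrices at the nodes `1` and `2` -/

/-- A real symmetric `2 × 2` matrix with positive upper left entry is positive semi-definite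
exactly when its determinant is nonnegative. -/
theorem posSemidef_two_iff {p q r : ℝ} (hp : 0 < p) :
    (!![(p : ℂ), q; q, r] : Matrix (Fin 2) (Fin 2) ℂ).PosSemidef ↔ q ^ 2 ≤ p * r := by
  constructor
  · intro h
    have := h.det_nonneg
    rw [Matrix.det_fin_two_of] at this
    have h' : (0 : ℝ) ≤ p * r - q * q := by exact_mod_cast this
    linarith
  · intro h
    refine Matrix.PosSemidef.of_dotProduct_mulVec_nonneg ?_ fun x => ?_
    · ext i j
      fin_cases i <;> fin_cases j <;> simp
    -- Completing the square, after multiplication by `p`.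
    · have e : star x ⬝ᵥ (!![(p : ℂ), q; q, r] : Matrix (Fin 2) (Fin 2) ℂ).mulVec x
          = (((Complex.normSq (p * x 0 + q * x 1) +
            (p * r - q ^ 2) * Complex.normSq (x 1)) / p : ℝ) : ℂ) := by
        have hp' : (p : ℂ) ≠ 0 := by exact_mod_cast hp.ne'
        push_cast
        rw [eq_div_iff hp']
        simp only [← Complex.mul_conj, dotProduct, Matrix.mulVec, Fin.sum_univ_two]
        simp
        ring
      rw [e]
      have := Complex.normSq_nonneg (p * x 0 + q * x 1)
      have := mul_nonneg (sub_nonneg.mpr h) (Complex.normSq_nonneg (x 1))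
      exact_mod_cast div_nonneg (by linarith) hp.le

theorem pickMatrix_two_eq {X : Type*} (κ : X → X → ℂ) (x : Fin 2 → X) (w : ℂ) {p q r : ℝ}
    (h00 : κ (x 0) (x 0) = p) (h01 : κ (x 0) (x 1) = q) (h10 : κ (x 1) (x 0) = q)
    (h11 : κ (x 1) (x 1) = r) :
    pickMatrix κ x ![0, w] = !![(p : ℂ), q; q, ((1 - ‖w‖ ^ 2) * r : ℝ)] := by
  ext i j
  fin_cases i <;> fin_cases j <;> simp [pickMatrix, h00, h01, h10, h11, Complex.mul_conj,
    Complex.normSq_eq_norm_sq]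

/-- The determinant condition `1 / 9 ≤ (1 - ‖w‖ ^ 2) / 8` means `‖w‖ ≤ 1 / 3`. -/
theorem not_posSemidef_pickMatrix_halfPlaneKernel {w : ℂ} (hw : 1 / 3 < ‖w‖) :
    ¬ (pickMatrix halfPlaneKernel nodes ![0, w]).PosSemidef := by
  rw [pickMatrix_two_eq halfPlaneKernel nodes w (p := 1 / 2) (q := 1 / 3) (r := 1 / 4),
    posSemidef_two_iff (by norm_num)]
  · nlinarith
  all_goals simp [halfPlaneKernel, nodes, map_ofNat]; norm_num

/-- The ratio `b ^ 2 / (a * d)` is at most `1`, so its powers only decrease and the case `m = 1` is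
the most restrictive. -/
theorem posSemidef_pickMatrix_szegoDirichletKernel {m : ℕ} (hm : 0 < m) {w : ℂ} {a b d : ℝ}
    (ha : riemannZeta 2 = a) (hb : riemannZeta 3 = b) (hd : riemannZeta 4 = d) (ha0 : 0 < a)
    (hd0 : 0 < d) (h1 : b ^ 2 / (a * d) ≤ 1)
    (hw : ‖w‖ ^ 2 ≤ 1 - b ^ 2 / (a * d)) :
    (pickMatrix (szegoDirichletKernel ^ m) nodes ![0, w]).PosSemidef := by
  rw [pickMatrix_two_eq _ nodes w (p := a ^ m) (q := b ^ m) (r := d ^ m),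
    posSemidef_two_iff (by positivity)]
  · have h0 : 0 ≤ b ^ 2 / (a * d) := by positivity
    have h2 : (b ^ 2 / (a * d)) ^ m ≤ b ^ 2 / (a * d) := pow_le_of_le_one h0 h1 hm.ne'
    have h3 : (b ^ 2 / (a * d)) ^ m ≤ 1 - ‖w‖ ^ 2 := by linarith
    rw [div_pow, div_le_iff₀ (by positivity), mul_pow] at h3
    rw [← pow_mul, mul_comm m 2, pow_mul]
    linarith
  · have : (1 + 1 : ℂ) = 2 := by norm_num
    simp [szegoDirichletKernel, nodes, this, ha]
  · have : (1 + 2 : ℂ) = 3 := by norm_num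
    simp [szegoDirichletKernel, nodes, map_ofNat, this, hb]
  · have : (2 + 1 : ℂ) = 3 := by norm_num
    simp [szegoDirichletKernel, nodes, this, hb]
  · have : (2 + 2 : ℂ) = 4 := by norm_num
    simp [szegoDirichletKernel, nodes, map_ofNat, this, hd]

/-! ### The main theorem -/

theorem theorem1p2 (m : ℕ) (hm : 0 < m) :
    ¬ HasScalarPickProperty 2 (szegoDirichletKernel ^ m) ∧
    1 / 3 < √(1 - (riemannZeta 3 ^ 2 / (riemannZeta 2 * riemannZeta 4)).re) ∧
    ∀ w₂ : ℂ, 1 / 3 < ‖w₂‖ →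
      ‖w₂‖ < √(1 - (riemannZeta 3 ^ 2 / (riemannZeta 2 * riemannZeta 4)).re) →
      (pickMatrix (szegoDirichletKernel ^ m) nodes ![0, w₂]).PosSemidef ∧
      ¬ (pickMatrix halfPlaneKernel nodes ![0, w₂]).PosSemidef ∧
      ¬ ∃ φ : RightHalfPlane (1 / 2) → ℂ,
        IsContractiveMultiplier (szegoDirichletKernel ^ m) φ ∧
          ∀ j, φ (nodes j) = ![0, w₂] j := by
  obtain ⟨a, b, d, ha, hb, hd, ha0, hb0, hd0, hr⟩ := zeta_ratio_lt
  have hre : (riemannZeta 3 ^ 2 / (riemannZeta 2 * riemannZeta 4)).re = b ^ 2 / (a * d) := by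
    rw [ha, hb, hd]
    rw [← Complex.ofReal_pow, ← Complex.ofReal_mul, ← Complex.ofReal_div, Complex.ofReal_re]
  rw [hre]
  have hr0 : 0 ≤ b ^ 2 / (a * d) := by positivity
  -- This is where `8 / 9 = 1 - (1 / 3) ^ 2` enters.
  have hlt : 1 / 3 < √(1 - b ^ 2 / (a * d)) := Real.lt_sqrt_of_sq_lt (by linarith)
  have main : ∀ w₂ : ℂ, 1 / 3 < ‖w₂‖ → ‖w₂‖ < √(1 - b ^ 2 / (a * d)) →
      (pickMatrix (szegoDirichletKernel ^ m) nodes ![0, w₂]).PosSemidef ∧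
      ¬ (pickMatrix halfPlaneKernel nodes ![0, w₂]).PosSemidef ∧
      ¬ ∃ φ : RightHalfPlane (1 / 2) → ℂ,
        IsContractiveMultiplier (szegoDirichletKernel ^ m) φ ∧
          ∀ j, φ (nodes j) = ![0, w₂] j := by
    intro w h1 h2
    refine ⟨posSemidef_pickMatrix_szegoDirichletKernel hm ha hb hd ha0 hd0 (by linarith)
      ((Real.lt_sqrt (norm_nonneg _)).mp h2).le, not_posSemidef_pickMatrix_halfPlaneKernel h1, ?_⟩
    rintro ⟨φ, hφ, hw⟩
    have h := norm_multiplier_two_le m hφ (hw 0)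
    rw [hw 1] at h
    exact h1.not_ge h
  refine ⟨fun hP => ?_, hlt, main⟩
  obtain ⟨t, ht1, ht2⟩ := exists_between hlt
  have ht0 : 0 < t := by linarith
  have hn : ‖(t : ℂ)‖ = t := by rw [Complex.norm_real, Real.norm_of_nonneg ht0.le]
  obtain ⟨h1, -, h3⟩ := main t (by rwa [hn]) (by rwa [hn])
  refine h3 (hP nodes ![0, t] ?_ ?_ h1)
  · intro i j hij
    fin_cases i <;> fin_cases j <;> simp [nodes] at hij ⊢
  · have h1 : √(1 - b ^ 2 / (a * d)) ≤ 1 := Real.sqrt_le_one.mpr (by linarith)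
    intro j
    fin_cases j
    · simp
    · simpa [abs_of_pos ht0] using ht2.trans_le h1
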